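/- Let $J$ be a finite set of customer classes and let $X=\bigcup_{k\ge 0}J^k$ be the set of finite words over $J$ (configurations of a queue, listed in order of arrival), with empty word $\varnothing$. Let $P=(p_{ij})_{i,j\in J}$ be a routing matrix with $p_{ij}\ge 0$, $\sum_{j}p_{ij}\le 1$ and spectral radius $\rho(P)<1$ (the network is open). Let $\gamma(x,r)\ge 0$, for $x=(x_1,\dots,x_k)\in X$ and $1\le r\le k$, be the service rate of the $r$-th customer of $x$, and suppose that for some constants $0<\gamma_-\le\gamma_+<\infty$ $$\gamma_-\le\sum_{r=1}^{|x|}\gamma(x,r)\le\gamma_+\qquad\text{for all } x\in X,\ x\ne\varnothing .$$ For a probability measure $\mu$ on $X$ and a vector $\lambda=(\lambda_j)_{j\in J}$ with $\lambda_j\ge0$ put $$u_j(\mu)=\sum_{x\in X}\mu(x)\sum_{r:\,x_r=j}\gamma(x,r),\qquad w_j(\mu)=\sum_{i\in J}p_{ij}u_i(\mu),\qquad v_j(\mu)=\lambda_j+w_j(\mu).$$ Write $x\ominus x_r$ for $x$ with its $r$-th letter removed and $x\oplus j$ for $x$ with the letter $j$ appended at the end. The state $(\mu_t)_{t\ge0}$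 of the non-linear Markov process (NLMP) with constant external inflow $\lambda$ is a family of probability measures on $X$ satisfying, coordinatewise on $X$ and for all $t\ge 0$ (with the one-sided derivative at $t=0$), $$\dot\mu_t=\sum_{x\in X}\mu_t(x)\Big[\sum_{r=1}^{|x|}\gamma(x,r)\,(\delta_{x\ominus x_r}-\delta_x)+\sum_{j\in J}v_j(\mu_t)\,(\delta_{x\oplus j}-\delta_x)\Big].$$ A stationary state is a probability measure $\mu^*$ on $X$ such that $\mu_t\equiv\mu^*$ is a solution. **Lemma.** 1. The matrix $I-P^{T}$ is invertible, and for every $\lambda$ with $\lambda_j\ge 0$ each stationary state $\mu^*$ (if there is one) has internal inflow $$w(\mu^*)=(I-P^{T})^{-1}P^{T}\lambda .$$ 2. There is $\varepsilon>0$ (depending only on the network $(J,P,\gamma)$) such that for every constant external inflow $\lambda$ with $0\le\lambda_j\le\varepsilon$ for all $j\in J$, the NLMP has exactly one stationary state $\mu^*$. -/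

import Mathlib

open scoped Matrix

noncomputable section

/-- An open queueing network with finite set `J` of customer classes. Configurations are the finite
words over `J`, that is `List J`, listed in order of arrival (head = oldest customer). -/
structure OpenNetwork (J : Type*) [Fintype J] [DecidableEq J] where
  /-- Routing matrix: `P i j` is the probability that a served customer of class `i` becomes a
  customer of class `j`; with probability `1 - ∑ j, P i j` it leaves the network. -/
  P : Matrix J J ℝ
  P_nonneg : ∀ i j, 0 ≤ P i j
  P_row_sum_le_one : ∀ i, ∑ j, P i j ≤ 1
  /-- The network is open: the spectral radius of `P` is less than one. -/
  spectralRadius_lt_one : spectralRadius ℂ (P.map Complex.ofReal) < 1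
  /-- Service discipline: `γ x r` is the service rate, in the queue `x`, of the customer at
  position `r` of `x`. -/
  γ : (x : List J) → Fin x.length → ℝ
  γ_nonneg : ∀ x r, 0 ≤ γ x r
  /-- Bounds on the total service rate of a nonempty queue. -/
  γminus : ℝ
  γplus : ℝ
  γminus_pos : 0 < γminus
  γminus_le : ∀ x : List J, x ≠ [] → γminus ≤ ∑ r, γ x r
  le_γplus : ∀ x : List J, x ≠ [] → ∑ r, γ x r ≤ γplus

/-- `μ` is a probability vector on the countable set `X`. -/
def IsProbabilityVector {X : Type*} (μ : X → ℝ) : Prop :=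
  (∀ x, 0 ≤ μ x) ∧ HasSum μ 1

/-- The coordinates of the unit mass at `x`. -/
def unitMass {X : Type*} [DecidableEq X] (x y : X) : ℝ := if y = x then 1 else 0

namespace OpenNetwork

variable {J : Type*} [Fintype J] [DecidableEq J] (G : OpenNetwork J)

/-- Outflow rate of class `j` customers in the state `μ`. -/
def outflow (μ : List J → ℝ) (j : J) : ℝ :=
  ∑' x : List J, μ x * ∑ r : Fin x.length, if x.get r = j then G.γ x r else 0

/-- Internal inflow rates `w j = ∑ i, p i j * u i`, where `u` is the vector of outflow rates. -/
def internalInflow (μ : List J → ℝ) (j : J) : ℝ :=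
  ∑ i, G.P i j * G.outflow μ i

/-- Total inflow rates `v = lam + w`. -/
def totalInflow (lam : J → ℝ) (μ : List J → ℝ) (j : J) : ℝ :=
  lam j + G.internalInflow μ j

/-- The coordinate at `y` of the right-hand side of the evolution equation. A service of the
customer at position `r` takes `x` to `x.eraseIdx r`; an arrival of class `j` takes `x` to
`x ++ [j]`. -/
def evolutionRHS (lam : J → ℝ) (μ : List J → ℝ) (y : List J) : ℝ :=
  ∑' x : List J, μ x *
    ((∑ r : Fin x.length, G.γ x r * (unitMass (x.eraseIdx r) y - unitMass x y)) +
      ∑ j, G.totalInflow lam μ j * (unitMass (x ++ [j]) y - unitMass x y))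

/-- `μ t`, `t ≥ 0`, is the evolution of the state of the non-linear Markov process with external
inflow rates `lam t`: each `μ t` is a probability measure on the set of configurations and the
countable system of ordinary differential equations holds coordinatewise on `[0, ∞)`. -/
structure IsNLMPEvolution (lam : ℝ → J → ℝ) (μ : ℝ → List J → ℝ) : Prop where
  isProbabilityVector : ∀ t, 0 ≤ t → IsProbabilityVector (μ t)
  hasDeriv : ∀ t, 0 ≤ t → ∀ y,
    HasDerivWithinAt (fun s => μ s y) (G.evolutionRHS (lam t) (μ t) y) (Set.Ici 0) t

/-- `μ` is a stationary state of the non-linear Markov process with constant external inflow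
`lam`: the constant path at `μ` is an evolution. -/
def IsStationaryState (lam : J → ℝ) (μ : List J → ℝ) : Prop :=
  G.IsNLMPEvolution (fun _ => lam) (fun _ => μ)

end OpenNetwork

end

/-!
Fix the arrival rates `v`. A single queue with these rates is a linear Markov jump process with
bounded rates, and `μ` is stationary for the non-linear process exactly when it is stationary for
the queue with `v = totalInflow lam μ`.

*Rate conservation* (`OpenNetwork.outflow_eq`). In a stationary distribution the outflow rate of
each class equals its arrival rate `v j`. The number `N` of customers of class `j` may have infinite
mean, so the generator is applied to the bounded functions `min N K`; since `N` jumps by at most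
one, dominated convergence permits `K → ∞` (`tsum_mul_jumpGenerator_eq_zero`). Hence `v` solves the
traffic equations `v = lam + Pᵀ v`. As the spectral radius of `P` is less than one, `1 - Pᵀ` is
invertible, so `v = (1 - Pᵀ)⁻¹ lam`, which gives the formula for the internal inflow. It also
reduces stationarity for the non-linear process to stationarity for one linear queue, with these
arrival rates (`OpenNetwork.isStationaryState_iff_traffic`).

*Uniqueness* (`stationary_unique`). Services lead from every configuration to the empty one. If
`μ` and `ν` are stationary, some combination `d` of them vanishes at the empty configuration, and
`|d|` is subinvariant. Summing over all configurations, `|d|` is invariant; as it vanishes at the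
empty configuration, it vanishes at every configuration from which the empty one can be reached.

*Existence* (`exists_stationary`). If `lam` is small, the total arrival rate is small compared with
the total service rate of a nonempty queue, and `2 ^ |x|` is a Lyapunov function. Then the Green's
function of the jump chain killed at the empty configuration is finite
(`exists_green_function`), and divided by the exit rates it is an invariant measure.
-/

/-! ### Jump processes with bounded rates -/

section JumpProcess

variable {X : Type*} {I : X → Type*} [∀ x, Fintype (I x)]
  (rate : ∀ x, I x → ℝ) (target : ∀ x, I x → X)

/-- The generator of the jump process that leaves `x` along the move `i : I x`, towards
`target x i`, at rate `rate x i`. Moves with `target x i = x` are allowed and have no effect. -/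
def jumpGenerator (f : X → ℝ) (x : X) : ℝ :=
  ∑ i, rate x i * (f (target x i) - f x)

variable {rate target} in
lemma abs_jumpGenerator_le {f : X → ℝ} {x : X} {B C : ℝ} (hB : 0 ≤ B)
    (hf : ∀ i, |f (target x i) - f x| ≤ B) (hC : ∑ i, |rate x i| ≤ C) :
    |jumpGenerator rate target f x| ≤ C * B :=
  calc |jumpGenerator rate target f x| ≤ ∑ i, |rate x i * (f (target x i) - f x)| :=
        Finset.abs_sum_le_sum_abs _ _
    _ ≤ ∑ i, |rate x i| * B := Finset.sum_le_sum fun i _ => by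
        rw [abs_mul]; exact mul_le_mul_of_nonneg_left (hf i) (abs_nonneg _)
    _ ≤ C * B := by
        rw [← Finset.sum_mul]; exact mul_le_mul_of_nonneg_right hC hB

lemma summable_mul_of_abs_le {α : Type*} {ψ g : α → ℝ} {C : ℝ} (hψ : Summable ψ)
    (hg : ∀ x, |g x| ≤ C) : Summable fun x => ψ x * g x := by
  refine Summable.of_norm_bounded (hψ.abs.mul_right C) fun x => ?_
  rw [Real.norm_eq_abs, abs_mul]
  exact mul_le_mul_of_nonneg_left (hg x) (abs_nonneg _)

variable [DecidableEq X]

/-- The coordinate at `y` of the right-hand side of the forward (master) equation. -/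
noncomputable def masterRHS (ψ : X → ℝ) (y : X) : ℝ :=
  ∑' x, ψ x * jumpGenerator rate target (fun z => unitMass z y) x

/-- The total rate of the moves from `x` to `y`. -/
noncomputable def transitionRate (x y : X) : ℝ :=
  ∑ i, rate x i * unitMass (target x i) y

variable {rate target}

lemma unitMass_nonneg (x y : X) : 0 ≤ unitMass x y := by
  unfold unitMass; split_ifs <;> norm_num

lemma hasSum_mul_unitMass (f : X → ℝ) (x : X) : HasSum (fun y => f y * unitMass x y) (f x) := by
  have h := hasSum_single (f := fun y => f y * unitMass x y) x
    (fun y hy => by simp [unitMass, hy])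
  simpa [unitMass] using h

lemma hasSum_mul_transitionRate (f : X → ℝ) (x : X) :
    HasSum (fun y => f y * transitionRate rate target x y)
      (∑ i, rate x i * f (target x i)) := by
  have h := hasSum_sum (s := Finset.univ) fun i _ =>
    (hasSum_mul_unitMass f (target x i)).mul_left (rate x i)
  refine h.congr_fun fun y => ?_
  simp only [transitionRate, Finset.mul_sum]
  exact Finset.sum_congr rfl fun i _ => by ring

lemma transitionRate_nonneg (hrate : ∀ x i, 0 ≤ rate x i) (x y : X) :
    0 ≤ transitionRate rate target x y :=
  Finset.sum_nonneg fun i _ => mul_nonneg (hrate x i) (unitMass_nonneg _ _)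

lemma jumpGenerator_unitMass (x y : X) :
    jumpGenerator rate target (fun z => unitMass z y) x =
      transitionRate rate target x y - (∑ i, rate x i) * unitMass x y := by
  simp only [jumpGenerator, transitionRate, Finset.sum_mul, ← Finset.sum_sub_distrib, mul_sub]

lemma hasSum_mul_jumpGenerator_unitMass (f : X → ℝ) (x : X) :
    HasSum (fun y => f y * jumpGenerator rate target (fun z => unitMass z y) x)
      (jumpGenerator rate target f x) := by
  have h := (hasSum_mul_transitionRate (rate := rate) (target := target) f x).sub
    ((hasSum_mul_unitMass f x).mul_left (∑ i, rate x i))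
  rw [Finset.sum_mul, ← Finset.sum_sub_distrib] at h
  simp only [← mul_sub] at h
  refine h.congr_fun fun y => ?_
  rw [jumpGenerator_unitMass]; ring

/-- The kernel of the generator is dominated by replacing each rate by its absolute value and each
difference of unit masses by their sum. -/
lemma exists_majorant_jumpGenerator_unitMass (rate : ∀ x, I x → ℝ) (target : ∀ x, I x → X) :
    ∃ M : X → X → ℝ, (∀ x y, |jumpGenerator rate target (fun z => unitMass z y) x| ≤ M x y) ∧
      ∀ x, HasSum (M x) (2 * ∑ i, |rate x i|) := by
  refine ⟨fun x y => transitionRate (fun x i => |rate x i|) target x y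
    + (∑ i, |rate x i|) * unitMass x y, fun x y => ?_, fun x => ?_⟩
  · rw [jumpGenerator_unitMass]
    refine (abs_sub _ _).trans (add_le_add ?_ ?_)
    · refine (Finset.abs_sum_le_sum_abs _ _).trans (le_of_eq (Finset.sum_congr rfl fun i _ => ?_))
      rw [abs_mul, abs_of_nonneg (unitMass_nonneg _ _)]
    · rw [abs_mul, abs_of_nonneg (unitMass_nonneg _ _)]
      exact mul_le_mul_of_nonneg_right (Finset.abs_sum_le_sum_abs _ _) (unitMass_nonneg _ _)
  · have h := (hasSum_mul_transitionRate (rate := fun x i => |rate x i|) (target := target)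
      (fun _ => 1) x).add ((hasSum_mul_unitMass (fun _ => 1) x).mul_left (∑ i, |rate x i|))
    simp only [mul_one, one_mul, ← two_mul] at h
    exact h

/-- Duality between the master equation and the generator: a bounded test function may be moved
across, because for bounded rates the double sum converges absolutely. -/
lemma hasSum_mul_masterRHS {ψ f : X → ℝ} {B C : ℝ} (hψ : Summable ψ) (hf : ∀ x, |f x| ≤ B)
    (hC : ∀ x, ∑ i, |rate x i| ≤ C) :
    HasSum (fun y => f y * masterRHS rate target ψ y)
      (∑' x, ψ x * jumpGenerator rate target f x) := by
  obtain ⟨M, hle, hM⟩ := exists_majorant_jumpGenerator_unitMass rate target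
  have hM0 : ∀ x y, 0 ≤ M x y := fun x y => (abs_nonneg _).trans (hle x y)
  have hmass : Summable fun x => |ψ x| * (2 * ∑ i, |rate x i|) := by
    refine summable_mul_of_abs_le (C := 2 * C) hψ.abs fun x => ?_
    rw [abs_of_nonneg (mul_nonneg zero_le_two (Finset.sum_nonneg fun i _ => abs_nonneg _))]
    exact mul_le_mul_of_nonneg_left (hC x) zero_le_two
  have hrow : ∀ x, HasSum (fun y => |ψ x| * M x y) (|ψ x| * (2 * ∑ i, |rate x i|)) := fun x =>
    (hM x).mul_left _
  have hsum : Summable fun p : X × X => |ψ p.1| * M p.1 p.2 := by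
    have h0 : 0 ≤ fun p : X × X => |ψ p.1| * M p.1 p.2 := fun p =>
      mul_nonneg (abs_nonneg _) (hM0 _ _)
    exact (summable_prod_of_nonneg h0).2
      ⟨fun x => (hrow x).summable, hmass.congr fun x => (hrow x).tsum_eq.symm⟩
  have hK : Summable (Function.uncurry fun x y =>
      ψ x * (f y * jumpGenerator rate target (fun z => unitMass z y) x)) := by
    refine Summable.of_norm_bounded (hsum.mul_left B) fun p => ?_
    simp only [Function.uncurry, Real.norm_eq_abs, abs_mul]
    have h := mul_le_mul (hf p.2) (hle p.1 p.2) (abs_nonneg _)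
      ((abs_nonneg _).trans (hf p.2))
    calc _ ≤ |ψ p.1| * (B * M p.1 p.2) := mul_le_mul_of_nonneg_left h (abs_nonneg _)
      _ = _ := by ring
  have h1 := hK.tsum_comm
  simp only [tsum_mul_left, (hasSum_mul_jumpGenerator_unitMass f _).tsum_eq] at h1
  rw [← h1]
  refine hK.prod_symm.prod.hasSum.congr_fun fun y => ?_
  rw [masterRHS, ← tsum_mul_left]
  exact tsum_congr fun x => by simp only [Prod.swap, Function.uncurry]; ring

/-- In a stationary state the mean drift of an integer observable with jumps of size at most one
vanishes, even if the observable has infinite mean. -/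
lemma tsum_mul_jumpGenerator_eq_zero {μ : X → ℝ} {C : ℝ} (hμ : Summable μ)
    (hC : ∀ x, ∑ i, |rate x i| ≤ C) (hstat : ∀ y, masterRHS rate target μ y = 0) (N : X → ℕ)
    (hN : ∀ x i, |(N (target x i) : ℝ) - N x| ≤ 1) :
    ∑' x, μ x * jumpGenerator rate target (fun z => (N z : ℝ)) x = 0 := by
  have htrunc : ∀ K : ℕ,
      ∑' x, μ x * jumpGenerator rate target (fun z => min (N z : ℝ) K) x = 0 := fun K => by
    have h := hasSum_mul_masterRHS (f := fun z => min (N z : ℝ) K) (B := K) hμ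
      (fun x => by
        rw [abs_of_nonneg (le_min (Nat.cast_nonneg _) (Nat.cast_nonneg _))]
        exact min_le_right _ _) hC (target := target)
    simp only [hstat, mul_zero] at h
    exact h.unique hasSum_zero
  refine tendsto_nhds_unique (f := fun K : ℕ =>
    ∑' x, μ x * jumpGenerator rate target (fun z => min (N z : ℝ) K) x)
    (l := Filter.atTop) ?_ (by simp only [htrunc]; exact tendsto_const_nhds)
  refine tendsto_tsum_of_dominated_convergence (hμ.abs.mul_right (C * 1)) (fun x => ?_)
    (Filter.Eventually.of_forall fun K x => ?_)
  · refine tendsto_const_nhds.congr' ?_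
    filter_upwards [Filter.eventually_ge_atTop (N x + 1)] with K hK
    have hK' : (N x : ℝ) + 1 ≤ K := by exact_mod_cast hK
    simp only [jumpGenerator]
    refine congrArg _ (Finset.sum_congr rfl fun i _ => ?_)
    have := abs_le.1 (hN x i)
    rw [min_eq_left (by linarith), min_eq_left (by linarith)]
  · rw [Real.norm_eq_abs, abs_mul]
    refine mul_le_mul_of_nonneg_left (abs_jumpGenerator_le zero_le_one (fun i => ?_) (hC x))
      (abs_nonneg _)
    have := abs_le.1 (hN x i)
    rw [abs_le]
    constructor <;> rcases min_cases (N (target x i) : ℝ) K with ⟨h, _⟩ | ⟨h, _⟩ <;>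
      rcases min_cases (N x : ℝ) K with ⟨h', _⟩ | ⟨h', _⟩ <;> rw [h, h'] <;> linarith

/-- The right-hand side of the master equation as inflow minus outflow. -/
lemma masterRHS_eq {ψ : X → ℝ} {C : ℝ} (hψ : Summable ψ) (hrate : ∀ x i, 0 ≤ rate x i)
    (hC : ∀ x, ∑ i, rate x i ≤ C) (y : X) :
    Summable (fun x => ψ x * transitionRate rate target x y) ∧
    masterRHS rate target ψ y =
      (∑' x, ψ x * transitionRate rate target x y) - ψ y * ∑ i, rate y i := by
  have hs : Summable (fun x => ψ x * transitionRate rate target x y) := by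
    refine summable_mul_of_abs_le (C := C) hψ fun x => ?_
    rw [abs_of_nonneg (transitionRate_nonneg hrate _ _)]
    refine le_trans (Finset.sum_le_sum fun i _ => ?_) (hC x)
    refine mul_le_of_le_one_right (hrate x i) ?_
    unfold unitMass; split_ifs <;> norm_num
  have h2 : HasSum (fun x => ψ x * ((∑ i, rate x i) * unitMass x y)) (ψ y * ∑ i, rate y i) := by
    have := hasSum_mul_unitMass (fun x => ψ x * ∑ i, rate x i) y
    refine this.congr_fun fun x => ?_
    simp only [unitMass, eq_comm (a := x)]; ring
  refine ⟨hs, ?_⟩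
  rw [← h2.tsum_eq, ← hs.tsum_sub h2.summable]
  exact tsum_congr fun x => by rw [jumpGenerator_unitMass, mul_sub]

/-! ### Uniqueness of the stationary distribution -/

/-- A subinvariant summable `ψ ≥ 0` (one with `masterRHS ψ ≥ 0`) is invariant, since the
coordinates of `masterRHS ψ` add up to zero. If it vanishes at `o` it vanishes everywhere: by
induction on the rank of `x`, the mass at `x` would flow into states of smaller rank. -/
lemma eq_zero_of_masterRHS_nonneg {ψ : X → ℝ} {C : ℝ} {o : X} {rank : X → ℕ}
    (hrate : ∀ x i, 0 ≤ rate x i) (hC : ∀ x, ∑ i, rate x i ≤ C)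
    (hrank : ∀ x, x ≠ o → ∃ i, 0 < rate x i ∧ rank (target x i) < rank x)
    (hψ : Summable ψ) (hψ0 : ∀ x, 0 ≤ ψ x) (ho : ψ o = 0)
    (hsub : ∀ y, 0 ≤ masterRHS rate target ψ y) (x : X) : ψ x = 0 := by
  have hsum := hasSum_mul_masterRHS (f := fun _ => 1) (B := 1) (rate := rate) (target := target)
    hψ (fun x => by simp) (fun x => by simpa only [abs_of_nonneg (hrate x _)] using hC x)
  simp only [jumpGenerator, sub_self, mul_zero, Finset.sum_const_zero, tsum_zero, one_mul] at hsum
  have hinv := (hasSum_zero_iff_of_nonneg hsub).1 hsum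
  induction hn : rank x using Nat.strong_induction_on generalizing x with
  | _ n ih =>
    by_cases hx : x = o
    · rw [hx, ho]
    obtain ⟨i, hi, hlt⟩ := hrank x hx
    have hy : ψ (target x i) = 0 := ih _ (hn ▸ hlt) _ rfl
    obtain ⟨hs, heq⟩ := masterRHS_eq (target := target) hψ hrate hC (target x i)
    have h0 : masterRHS rate target ψ (target x i) = 0 := congrFun hinv _
    rw [h0, hy, zero_mul, sub_zero] at heq
    have hz := hs.hasSum
    rw [← heq, hasSum_zero_iff_of_nonneg
      fun x => mul_nonneg (hψ0 x) (transitionRate_nonneg hrate _ _)] at hz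
    have hpos : 0 < transitionRate rate target x (target x i) := by
      refine Finset.sum_pos' (fun k _ => mul_nonneg (hrate x k) (unitMass_nonneg _ _))
        ⟨i, Finset.mem_univ _, ?_⟩
      simpa [unitMass] using hi
    exact (mul_eq_zero.1 (congrFun hz x)).resolve_right hpos.ne'

/-- The absolute value of an invariant signed vector is subinvariant, by the triangle inequality. -/
lemma masterRHS_abs_nonneg {ψ : X → ℝ} {C : ℝ} (hrate : ∀ x i, 0 ≤ rate x i)
    (hC : ∀ x, ∑ i, rate x i ≤ C) (hψ : Summable ψ)
    (hinv : ∀ y, masterRHS rate target ψ y = 0) (y : X) :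
    0 ≤ masterRHS rate target (fun x => |ψ x|) y := by
  obtain ⟨hs, h1⟩ := masterRHS_eq (target := target) hψ hrate hC y
  obtain ⟨-, h2⟩ := masterRHS_eq (target := target) hψ.abs hrate hC y
  rw [hinv y] at h1
  rw [h2, sub_nonneg, ← abs_of_nonneg (Finset.sum_nonneg fun i _ => hrate y i), ← abs_mul,
    ← sub_eq_zero.1 h1.symm]
  refine (norm_tsum_le_tsum_norm hs.norm).trans_eq (tsum_congr fun x => ?_)
  rw [Real.norm_eq_abs, abs_mul, abs_of_nonneg (transitionRate_nonneg hrate _ _)]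

/-- A jump process with bounded rates in which some state `o` can be reached from everywhere has
at most one stationary distribution. -/
lemma stationary_unique {μ ν : X → ℝ} {C : ℝ} {o : X} {rank : X → ℕ}
    (hrate : ∀ x i, 0 ≤ rate x i) (hC : ∀ x, ∑ i, rate x i ≤ C)
    (hrank : ∀ x, x ≠ o → ∃ i, 0 < rate x i ∧ rank (target x i) < rank x)
    (hμ : IsProbabilityVector μ) (hν : IsProbabilityVector ν)
    (hμs : ∀ y, masterRHS rate target μ y = 0) (hνs : ∀ y, masterRHS rate target ν y = 0) :
    μ = ν := by
  have hpos : μ o ≠ 0 := fun h0 => by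
    have h := eq_zero_of_masterRHS_nonneg hrate hC hrank hμ.2.summable hμ.1 h0
      (fun y => (hμs y).ge)
    have h1 := hμ.2
    rw [funext h] at h1
    exact one_ne_zero (h1.unique hasSum_zero)
  -- The combination of `μ` and `ν` that vanishes at `o`.
  set d : X → ℝ := fun x => ν o * μ x - μ o * ν x
  have hd : HasSum d (ν o * 1 - μ o * 1) := (hμ.2.mul_left _).sub (hν.2.mul_left _)
  have hds : ∀ y, masterRHS rate target d y = 0 := fun y => by
    obtain ⟨s1, e1⟩ := masterRHS_eq (target := target) hμ.2.summable hrate hC y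
    obtain ⟨s2, e2⟩ := masterRHS_eq (target := target) hν.2.summable hrate hC y
    rw [(masterRHS_eq hd.summable hrate hC y).2]
    have : ∑' x, d x * transitionRate rate target x y =
        ν o * (∑' x, μ x * transitionRate rate target x y)
          - μ o * ∑' x, ν x * transitionRate rate target x y := by
      rw [← tsum_mul_left, ← tsum_mul_left, ← (s1.mul_left _).tsum_sub (s2.mul_left _)]
      exact tsum_congr fun x => by simp only [d]; ring
    rw [this]
    linear_combination (-ν o) * (e1 - hμs y) + μ o * (e2 - hνs y)
  have hd0 : ∀ x, d x = 0 := fun x => abs_eq_zero.1 <|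
    eq_zero_of_masterRHS_nonneg (ψ := fun x => |d x|) hrate hC hrank hd.summable.abs
      (fun x => abs_nonneg _) (by simp [d, mul_comm])
      (masterRHS_abs_nonneg hrate hC hd.summable hds) x
  have ho : ν o = μ o := by
    have h1 := hd
    rw [funext hd0] at h1
    have := h1.unique hasSum_zero
    linarith
  ext x
  have := hd0 x
  simp only [d, ho] at this
  exact mul_left_cancel₀ hpos (sub_eq_zero.1 this)

/-! ### Existence of a stationary distribution -/

open scoped ENNReal in
/-- The Green's function of a kernel `k` with initial mass `b`, that is `∑ n, b k ^ n`, has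
finite total mass if `k` contracts the weight `W ≥ 1` by a factor `θ < 1`. -/
lemma exists_green_function {X : Type*} {k : X → X → ℝ≥0∞} {b W : X → ℝ≥0∞} {θ : ℝ≥0∞}
    (hθ : θ < 1) (hW : ∀ x, 1 ≤ W x) (hk : ∀ x, ∑' y, k x y * W y ≤ θ * W x)
    (hb : ∑' x, b x * W x ≠ ∞) :
    ∃ h : X → ℝ≥0∞, (∀ y, h y = b y + ∑' x, h x * k x y) ∧ ∑' x, h x ≠ ∞ := by
  set m : ℕ → X → ℝ≥0∞ := fun n => (fun (f : X → ℝ≥0∞) y => ∑' x, f x * k x y)^[n] b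
  have hm : ∀ n y, m (n + 1) y = ∑' x, m n x * k x y := fun n y => by
    simp only [m, Function.iterate_succ_apply']
  have hdecay : ∀ n, ∑' x, m n x * W x ≤ θ ^ n * ∑' x, b x * W x := fun n => by
    induction n with
    | zero => simp [m]
    | succ n ih =>
      calc ∑' y, m (n + 1) y * W y = ∑' y, ∑' x, m n x * k x y * W y := by
            simp only [hm, ENNReal.tsum_mul_right]
        _ = ∑' x, m n x * ∑' y, k x y * W y := by
            rw [ENNReal.tsum_comm]
            simp only [mul_assoc, ENNReal.tsum_mul_left]
        _ ≤ ∑' x, θ * (m n x * W x) := ENNReal.tsum_le_tsum fun x => by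
            rw [mul_left_comm]; gcongr; exact hk x
        _ ≤ θ ^ (n + 1) * ∑' x, b x * W x := by
            rw [ENNReal.tsum_mul_left, pow_succ', mul_assoc]; gcongr
  refine ⟨fun y => ∑' n, m n y, fun y => ?_, ?_⟩
  · beta_reduce
    rw [tsum_eq_zero_add' ENNReal.summable]
    simp only [hm, ← ENNReal.tsum_mul_right]
    rw [ENNReal.tsum_comm]
    rfl
  · refine ne_top_of_le_ne_top (b := (1 - θ)⁻¹ * ∑' x, b x * W x) ?_ ?_
    · exact ENNReal.mul_ne_top (ENNReal.inv_ne_top.2 (tsub_pos_of_lt hθ).ne') hb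
    · rw [ENNReal.tsum_comm, ← ENNReal.tsum_geometric, ← ENNReal.tsum_mul_right]
      refine ENNReal.tsum_le_tsum fun n => le_trans (ENNReal.tsum_le_tsum fun x => ?_) (hdecay n)
      exact le_mul_of_one_le_right' (hW x)

open scoped ENNReal in
/-- A Foster–Lyapunov criterion: if each jump from a state other than `o` decreases the weight `W`
on average by a factor `θ < 1`, there is a stationary distribution. It is the expected time spent
in each state during an excursion from `o`, up to normalisation. -/
lemma exists_stationary {W : X → ℝ} {c C θ : ℝ} {o : X}
    (hrate : ∀ x i, 0 ≤ rate x i) (hC : ∀ x, ∑ i, rate x i ≤ C) (hc : 0 < c)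
    (hcle : ∀ x, x ≠ o → c ≤ ∑ i, rate x i) (hθ : θ < 1) (hW : ∀ x, 1 ≤ W x)
    (hdrift : ∀ x, x ≠ o → ∑ i, rate x i * W (target x i) ≤ θ * (∑ i, rate x i) * W x) :
    ∃ μ : X → ℝ, IsProbabilityVector μ ∧ ∀ y, masterRHS rate target μ y = 0 := by
  have hq0 := transitionRate_nonneg (target := target) hrate
  have hW0 : ∀ x, 0 ≤ W x := fun x => zero_le_one.trans (hW x)
  have he : ∀ x, x ≠ o → 0 < ∑ i, rate x i := fun x hx => hc.trans_le (hcle x hx)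
  have hqW : ∀ x, HasSum (fun y => W y * transitionRate rate target x y)
    (∑ i, rate x i * W (target x i)) := hasSum_mul_transitionRate W
  -- The embedded jump chain, killed upon reaching `o`, is started from the exit measure of `o`.
  set k : X → X → ℝ≥0∞ := fun x y =>
    if x = o then 0 else ENNReal.ofReal (transitionRate rate target x y / ∑ i, rate x i)
  have hk : ∀ x, ∑' y, k x y * ENNReal.ofReal (W y) ≤
      ENNReal.ofReal θ * ENNReal.ofReal (W x) := fun x => by
    by_cases hx : x = o
    · simp [k, hx]
    have hs := (hqW x).div_const (∑ i, rate x i)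
    have hle : (∑ i, rate x i * W (target x i)) / (∑ i, rate x i) ≤ θ * W x := by
      rw [div_le_iff₀ (he x hx)]
      exact (hdrift x hx).trans_eq (by ring)
    simp only [k, if_neg hx]
    rw [← ENNReal.ofReal_mul' (hW0 x)]
    refine le_trans (le_of_eq ?_) (ENNReal.ofReal_le_ofReal hle)
    rw [← hs.tsum_eq, ENNReal.ofReal_tsum_of_nonneg
      (fun y => div_nonneg (mul_nonneg (hW0 y) (hq0 x y)) (he x hx).le) hs.summable]
    refine tsum_congr fun y => ?_
    rw [← ENNReal.ofReal_mul' (hW0 y)]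
    congr 1; ring
  have hb : ∑' y, ENNReal.ofReal (transitionRate rate target o y) * ENNReal.ofReal (W y) ≠ ∞ := by
    have h := (hqW o).summable.tsum_ofReal_ne_top
    refine ne_of_eq_of_ne (tsum_congr fun y => ?_) h
    rw [← ENNReal.ofReal_mul' (hW0 y), mul_comm]
  obtain ⟨h, hgreen, hfin⟩ := exists_green_function (θ := ENNReal.ofReal θ)
    (W := fun x => ENNReal.ofReal (W x)) (ENNReal.ofReal_lt_one.2 hθ)
    (fun x => ENNReal.one_le_ofReal.2 (hW x)) hk hb
  have hh : ∀ x, h x ≠ ∞ := ENNReal.ne_top_of_tsum_ne_top hfin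
  have hhs := ENNReal.summable_toReal hfin
  -- Dividing the visits of the jump chain by the exit rates gives the invariant measure,
  -- normalised to one at `o`.
  set ν : X → ℝ := fun x => if x = o then 1 else (h x).toReal / ∑ i, rate x i
  have hν0 : ∀ x, 0 ≤ ν x := fun x => by
    simp only [ν]
    split_ifs with hx
    · exact zero_le_one
    · exact div_nonneg ENNReal.toReal_nonneg (he x hx).le
  have hνs : Summable ν := by
    refine Summable.of_nonneg_of_le hν0 (fun x => ?_)
      ((hhs.div_const c).add (hasSum_mul_unitMass (fun _ => 1) o).summable)
    simp only [ν, unitMass]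
    split_ifs with hx
    · have : 0 ≤ (h x).toReal / c := div_nonneg ENNReal.toReal_nonneg hc.le
      linarith
    · have := div_le_div_of_nonneg_left (ENNReal.toReal_nonneg (a := h x)) hc (hcle x hx)
      simpa using this
  have hν : ∀ y, y ≠ o → masterRHS rate target ν y = 0 := fun y hy => by
    rw [(masterRHS_eq hνs hrate hC y).2, sub_eq_zero]
    have hterm : ∀ x, h x * k x y ≠ ∞ := fun x => by
      refine ENNReal.mul_ne_top (hh x) ?_
      simp only [k]; split_ifs
      · exact ENNReal.zero_ne_top
      · exact ENNReal.ofReal_ne_top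
    have htop : ∑' x, h x * k x y ≠ ∞ := fun ht => hh y (by rw [hgreen y, ht, add_top])
    have hy' := congrArg ENNReal.toReal (hgreen y)
    rw [ENNReal.toReal_add ENNReal.ofReal_ne_top htop, ENNReal.toReal_ofReal (hq0 o y),
      ENNReal.tsum_toReal_eq hterm] at hy'
    have ho := hasSum_mul_unitMass (fun _ => transitionRate rate target o y) o
    have hνy : ν y * ∑ i, rate y i = (h y).toReal := by
      simp only [ν, if_neg hy]
      exact div_mul_cancel₀ _ (he y hy).ne'
    rw [hνy, hy', ← ho.tsum_eq, ← ho.summable.tsum_add (ENNReal.summable_toReal htop)]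
    refine tsum_congr fun x => ?_
    by_cases hx : x = o
    · simp [ν, k, unitMass, hx]
    · simp only [ν, k, unitMass, if_neg hx, mul_zero, zero_add, ENNReal.toReal_mul]
      rw [ENNReal.toReal_ofReal (div_nonneg (hq0 x y) (he x hx).le)]
      ring
  -- The equation at `o` follows because the coordinates of the right-hand side add up to zero.
  have hνo : masterRHS rate target ν o = 0 := by
    have hsum := hasSum_mul_masterRHS (f := fun _ => 1) (B := 1) (rate := rate) (target := target)
      hνs (fun x => by simp) (fun x => by simpa only [abs_of_nonneg (hrate x _)] using hC x)
    simp only [jumpGenerator, sub_self, mul_zero, Finset.sum_const_zero, tsum_zero, one_mul]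
      at hsum
    exact (hasSum_single o hν).unique hsum
  have hZ : 0 < ∑' x, ν x := hνs.tsum_pos hν0 o (by simp [ν])
  refine ⟨fun x => ν x / ∑' x, ν x, ⟨fun x => div_nonneg (hν0 x) hZ.le, ?_⟩, fun y => ?_⟩
  · simpa [div_self hZ.ne'] using hνs.hasSum.div_const (∑' x, ν x)
  · have hy : masterRHS rate target ν y = 0 := by
      by_cases hy : y = o
      · rw [hy, hνo]
      · exact hν y hy
    simp only [masterRHS, div_mul_eq_mul_div, tsum_div_const] at hy ⊢
    rw [hy, zero_div]

end JumpProcess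

namespace OpenNetwork

variable {J : Type*} [Fintype J] [DecidableEq J] (G : OpenNetwork J)

/-! ### Traffic equations -/

lemma isUnit_one_sub_transpose : IsUnit (1 - G.Pᵀ) := by
  have h1 : (1 : ℂ) ∈ resolventSet ℂ (G.P.map Complex.ofReal) :=
    spectrum.mem_resolventSet_of_spectralRadius_lt (by simpa using G.spectralRadius_lt_one)
  rw [spectrum.mem_resolventSet_iff, map_one, Matrix.isUnit_iff_isUnit_det] at h1
  have h2 : (1 - G.P.map Complex.ofReal : Matrix J J ℂ) = (1 - G.P).map Complex.ofRealHom := by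
    ext i j
    simp [Matrix.one_apply, apply_ite Complex.ofReal]
  rw [h2, ← RingHom.mapMatrix_apply, ← RingHom.map_det, isUnit_iff_ne_zero] at h1
  have h3 : (1 - G.P).det ≠ 0 := fun h => h1 (by rw [h, map_zero])
  rw [Matrix.isUnit_iff_isUnit_det, isUnit_iff_ne_zero]
  rwa [← Matrix.det_transpose, Matrix.transpose_sub, Matrix.transpose_one] at h3

/-- The traffic equations `v = lam + Pᵀ v` have a unique solution. -/
lemma traffic_iff {lam v : J → ℝ} :
    v = lam + G.Pᵀ *ᵥ v ↔ v = (1 - G.Pᵀ)⁻¹ *ᵥ lam := by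
  have hdet := (Matrix.isUnit_iff_isUnit_det _).1 G.isUnit_one_sub_transpose
  rw [← sub_eq_iff_eq_add]
  have h : v - G.Pᵀ *ᵥ v = (1 - G.Pᵀ) *ᵥ v := by rw [Matrix.sub_mulVec, Matrix.one_mulVec]
  rw [h]
  constructor
  · intro h
    rw [← h, Matrix.mulVec_mulVec, Matrix.nonsing_inv_mul _ hdet, Matrix.one_mulVec]
  · rintro rfl
    rw [Matrix.mulVec_mulVec, Matrix.mul_nonsing_inv _ hdet, Matrix.one_mulVec]

lemma transpose_mulVec_inv (lam : J → ℝ) :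
    G.Pᵀ *ᵥ ((1 - G.Pᵀ)⁻¹ *ᵥ lam) = (1 - G.Pᵀ)⁻¹ *ᵥ (G.Pᵀ *ᵥ lam) := by
  have hdet := (Matrix.isUnit_iff_isUnit_det _).1 G.isUnit_one_sub_transpose
  have hc : Commute (1 - G.Pᵀ) G.Pᵀ := (Commute.one_left _).sub_left (Commute.refl _)
  rw [Matrix.mulVec_mulVec, Matrix.mulVec_mulVec]
  congr 1
  calc G.Pᵀ * (1 - G.Pᵀ)⁻¹
      = (1 - G.Pᵀ)⁻¹ * ((1 - G.Pᵀ) * G.Pᵀ) * (1 - G.Pᵀ)⁻¹ := by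
        rw [← mul_assoc, Matrix.nonsing_inv_mul _ hdet, one_mul]
    _ = (1 - G.Pᵀ)⁻¹ * G.Pᵀ := by
        rw [hc.eq, mul_assoc, mul_assoc, Matrix.mul_nonsing_inv _ hdet, mul_one]

/-- Solutions of the traffic equations are nonnegative. The negative part `n` of `v` satisfies
`n ≤ Pᵀ n`; as the row sums of `P` are at most one, both sides have the same total, so `n = Pᵀ n`
and hence `n = 0`. -/
lemma traffic_nonneg {lam v : J → ℝ} (hlam : ∀ j, 0 ≤ lam j) (hv : v = lam + G.Pᵀ *ᵥ v) (j : J) :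
    0 ≤ v j := by
  set n : J → ℝ := fun j => max (-v j) 0
  have hn0 : ∀ j, 0 ≤ n j := fun j => le_max_right _ _
  have happly : ∀ (w : J → ℝ) j, (G.Pᵀ *ᵥ w) j = ∑ i, G.P i j * w i := fun w j => rfl
  have hle : ∀ j ∈ Finset.univ, n j ≤ (G.Pᵀ *ᵥ n) j := fun j _ => by
    rw [happly]
    refine max_le ?_ (Finset.sum_nonneg fun i _ => mul_nonneg (G.P_nonneg i j) (hn0 i))
    have h1 : v j = lam j + ∑ i, G.P i j * v i := congrFun hv j
    have h2 : -∑ i, G.P i j * v i ≤ ∑ i, G.P i j * n i := by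
      rw [← Finset.sum_neg_distrib]
      refine Finset.sum_le_sum fun i _ => ?_
      rw [← mul_neg]
      exact mul_le_mul_of_nonneg_left (le_max_left _ _) (G.P_nonneg i j)
    linarith [hlam j]
  have htotal : ∑ j, (G.Pᵀ *ᵥ n) j ≤ ∑ j, n j := by
    simp only [happly]
    rw [Finset.sum_comm]
    refine Finset.sum_le_sum fun i _ => ?_
    rw [← Finset.sum_mul]
    exact mul_le_of_le_one_left (hn0 i) (G.P_row_sum_le_one i)
  have heq := (Finset.sum_eq_sum_iff_of_le hle).1 (le_antisymm (Finset.sum_le_sum hle) htotal)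
  have hn : n = 0 := by
    have h : n = (1 - G.Pᵀ)⁻¹ *ᵥ 0 := G.traffic_iff.1 (by
      ext j; rw [zero_add]; exact heq j (Finset.mem_univ j))
    rwa [Matrix.mulVec_zero] at h
  have : max (-v j) 0 = 0 := congrFun hn j
  linarith [le_max_left (-v j) 0]

/-! ### The queue with constant arrival rates -/

/-- The rates of the moves of a queue with Poisson arrivals at rates `v`: the move `Sum.inl r` is
the service of the customer at position `r`, the move `Sum.inr j` an arrival of class `j`. -/
def moveRate (v : J → ℝ) (x : List J) : Fin x.length ⊕ J → ℝ :=
  Sum.elim (G.γ x) v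

/-- The configurations to which the moves of a queue lead. -/
def moveTarget (x : List J) : Fin x.length ⊕ J → List J :=
  Sum.elim (fun r => x.eraseIdx r) (fun j => x ++ [j])

lemma evolutionRHS_eq_masterRHS (lam : J → ℝ) (μ : List J → ℝ) (y : List J) :
    G.evolutionRHS lam μ y = masterRHS (G.moveRate (G.totalInflow lam μ)) moveTarget μ y := by
  simp only [evolutionRHS, masterRHS, jumpGenerator, Fintype.sum_sum_type, moveRate, moveTarget,
    Sum.elim_inl, Sum.elim_inr]

lemma isStationaryState_iff {lam : J → ℝ} {μ : List J → ℝ} :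
    G.IsStationaryState lam μ ↔ IsProbabilityVector μ ∧
      ∀ y, masterRHS (G.moveRate (G.totalInflow lam μ)) moveTarget μ y = 0 := by
  simp only [← evolutionRHS_eq_masterRHS]
  constructor
  · intro h
    refine ⟨h.isProbabilityVector 0 le_rfl, fun y => ?_⟩
    exact (uniqueDiffOn_Ici (0 : ℝ) 0 Set.self_mem_Ici).eq_deriv _ (h.hasDeriv 0 le_rfl y)
      (hasDerivWithinAt_const (0 : ℝ) _ _)
  · rintro ⟨h1, h2⟩
    exact ⟨fun _ _ => h1, fun t _ y => by simpa only [h2] using hasDerivWithinAt_const t _ _⟩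

lemma sum_γ_le (x : List J) : ∑ r, G.γ x r ≤ |G.γplus| := by
  rcases eq_or_ne x [] with rfl | hx
  · simp
  · exact (G.le_γplus x hx).trans (le_abs_self _)

lemma sum_abs_moveRate_le (v : J → ℝ) (x : List J) :
    ∑ i, |G.moveRate v x i| ≤ |G.γplus| + ∑ j, |v j| := by
  simp only [Fintype.sum_sum_type, moveRate, Sum.elim_inl, Sum.elim_inr,
    abs_of_nonneg (G.γ_nonneg x _)]
  gcongr
  exact G.sum_γ_le x

lemma count_eraseIdx_cast {J : Type*} [DecidableEq J] (x : List J) (r : Fin x.length) (j : J) :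
    ((x.eraseIdx r).count j : ℝ) - x.count j = -(if x.get r = j then 1 else 0) := by
  have h := (List.getElem_cons_eraseIdx_perm r.isLt).count_eq j
  rw [List.count_cons] at h
  rw [← h]
  simp only [List.get_eq_getElem, beq_iff_eq]
  push_cast
  split_ifs <;> ring

/-- Rate conservation: in a stationary distribution of the queue with arrival rates `v`, the
outflow rate of each class equals its arrival rate. -/
lemma outflow_eq {v : J → ℝ} {μ : List J → ℝ} (hμ : IsProbabilityVector μ)
    (hs : ∀ y, masterRHS (G.moveRate v) moveTarget μ y = 0) : G.outflow μ = v := by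
  ext j
  have h := tsum_mul_jumpGenerator_eq_zero hμ.2.summable (G.sum_abs_moveRate_le v) hs
    (fun x => x.count j) (fun x i => by
      rcases i with r | i
      · simp only [moveTarget, Sum.elim_inl, count_eraseIdx_cast]
        split_ifs <;> norm_num
      · simp only [moveTarget, Sum.elim_inr, List.count_append, List.count_singleton]
        split_ifs <;> norm_num)
  have hgen : ∀ x : List J, jumpGenerator (G.moveRate v) moveTarget
      (fun z => ((z.count j : ℕ) : ℝ)) x =
        v j - ∑ r : Fin x.length, if x.get r = j then G.γ x r else 0 := fun x => by
    simp only [jumpGenerator, Fintype.sum_sum_type, moveRate, moveTarget, Sum.elim_inl,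
      Sum.elim_inr, count_eraseIdx_cast, List.count_append, List.count_singleton]
    simp [sub_eq_add_neg, add_comm]
  have hsum : Summable fun x : List J =>
      μ x * ∑ r : Fin x.length, if x.get r = j then G.γ x r else 0 := by
    refine summable_mul_of_abs_le (C := |G.γplus|) hμ.2.summable fun x => ?_
    have h0 : ∀ r, 0 ≤ if x.get r = j then G.γ x r else 0 := fun r => by
      split_ifs
      exacts [G.γ_nonneg x r, le_rfl]
    rw [abs_of_nonneg (Finset.sum_nonneg fun r _ => h0 r)]
    refine (Finset.sum_le_sum fun r _ => ?_).trans (G.sum_γ_le x)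
    split_ifs
    exacts [le_rfl, G.γ_nonneg x r]
  simp only [hgen, mul_sub] at h
  rw [(hμ.2.summable.mul_right (v j)).tsum_sub hsum, tsum_mul_right, hμ.2.tsum_eq, one_mul] at h
  exact (sub_eq_zero.1 h).symm

lemma totalInflow_eq_add (lam : J → ℝ) (μ : List J → ℝ) :
    G.totalInflow lam μ = lam + G.Pᵀ *ᵥ G.outflow μ := rfl

/-- The stationary states of the non-linear process are the stationary distributions of the queue
whose arrival rates solve the traffic equations. -/
lemma isStationaryState_iff_traffic {lam : J → ℝ} {μ : List J → ℝ} :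
    G.IsStationaryState lam μ ↔ IsProbabilityVector μ ∧
      ∀ y, masterRHS (G.moveRate ((1 - G.Pᵀ)⁻¹ *ᵥ lam)) moveTarget μ y = 0 := by
  rw [isStationaryState_iff]
  refine and_congr_right fun hμ => ?_
  suffices h : ((∀ y, masterRHS (G.moveRate (G.totalInflow lam μ)) moveTarget μ y = 0) ∨
      ∀ y, masterRHS (G.moveRate ((1 - G.Pᵀ)⁻¹ *ᵥ lam)) moveTarget μ y = 0) →
      G.totalInflow lam μ = (1 - G.Pᵀ)⁻¹ *ᵥ lam by
    exact ⟨fun hs => h (Or.inl hs) ▸ hs, fun hs => (h (Or.inr hs)).symm ▸ hs⟩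
  rintro (hs | hs)
  · have h := G.totalInflow_eq_add lam μ
    rw [G.outflow_eq hμ hs] at h
    exact G.traffic_iff.1 h
  · rw [totalInflow_eq_add, G.outflow_eq hμ hs]
    exact (G.traffic_iff.2 rfl).symm

lemma internalInflow_eq {lam : J → ℝ} {μ : List J → ℝ} (h : G.IsStationaryState lam μ) :
    G.internalInflow μ = (1 - G.Pᵀ)⁻¹ *ᵥ (G.Pᵀ *ᵥ lam) := by
  obtain ⟨hμ, hs⟩ := G.isStationaryState_iff_traffic.1 h
  rw [← transpose_mulVec_inv, ← G.outflow_eq hμ hs]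
  rfl

/-- A queue whose total arrival rate is at most a fifth of the minimal total service rate has
exactly one stationary distribution. The Lyapunov function is `2 ^ |x|`; the constants `1 / 5` and
`3 / 4` are such that `s / 2 + 2 a ≤ (3 / 4) (s + a)` when `5 a ≤ s`. -/
lemma existsUnique_stationary {v : J → ℝ} (hv : ∀ j, 0 ≤ v j) (hsmall : 5 * ∑ j, v j ≤ G.γminus) :
    ∃! μ : List J → ℝ, IsProbabilityVector μ ∧
      ∀ y, masterRHS (G.moveRate v) moveTarget μ y = 0 := by
  have hrate : ∀ x i, 0 ≤ G.moveRate v x i := fun x i => by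
    rcases i with r | j
    exacts [G.γ_nonneg x r, hv j]
  have hC : ∀ x, ∑ i, G.moveRate v x i ≤ |G.γplus| + ∑ j, |v j| := fun x => by
    simpa only [abs_of_nonneg (hrate x _)] using G.sum_abs_moveRate_le v x
  have hsum : ∀ x, ∑ i, G.moveRate v x i = ∑ r, G.γ x r + ∑ j, v j := fun x => by
    simp [moveRate]
  have hlen : ∀ (x : List J) (r : Fin x.length), (x.eraseIdx r).length + 1 = x.length :=
    fun x r => by have := r.isLt; rw [List.length_eraseIdx_of_lt r.isLt]; omega
  obtain ⟨μ, hμ, hs⟩ := exists_stationary (rate := G.moveRate v) (target := moveTarget) (o := [])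
    (W := fun x => 2 ^ x.length) (c := G.γminus) (θ := 3 / 4) hrate hC G.γminus_pos
    (fun x hx => by
      rw [hsum]; linarith [G.γminus_le x hx, Finset.sum_nonneg fun j (_ : j ∈ Finset.univ) => hv j])
    (by norm_num) (fun x => one_le_pow₀ one_le_two) (fun x hx => by
      have h1 : ∀ r : Fin x.length, G.γ x r * (2 : ℝ) ^ (x.eraseIdx r).length =
          G.γ x r * (2 ^ x.length / 2) := fun r => by
        have h2 : (2 : ℝ) ^ x.length = 2 ^ (x.eraseIdx r).length * 2 := by
          rw [← pow_succ, hlen]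
        rw [h2, mul_div_cancel_right₀ _ two_ne_zero]
      rw [hsum]
      simp only [Fintype.sum_sum_type, moveRate, moveTarget, Sum.elim_inl, Sum.elim_inr, h1,
        List.length_append, List.length_singleton, ← Finset.sum_mul, pow_succ]
      have h2 : 5 * ∑ j, v j ≤ ∑ r, G.γ x r := hsmall.trans (G.γminus_le x hx)
      nlinarith [pow_pos (two_pos (α := ℝ)) x.length])
  refine ⟨μ, ⟨hμ, hs⟩, fun ν hν => stationary_unique hrate hC (o := []) (rank := List.length)
    (fun x hx => ?_) hν.1 hμ hν.2 hs⟩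
  have hpos : 0 < ∑ r, G.γ x r := G.γminus_pos.trans_le (G.γminus_le x hx)
  obtain ⟨r, -, hr⟩ := Finset.exists_lt_of_sum_lt (s := Finset.univ) (f := fun _ => (0 : ℝ))
    (g := G.γ x) (by simpa using hpos)
  exact ⟨Sum.inl r, hr, Nat.lt_of_succ_le (hlen x r).le⟩

end OpenNetwork

theorem mainTheorem2 {J : Type*} [Fintype J] [DecidableEq J] (G : OpenNetwork J) :
    IsUnit (1 - G.Pᵀ) ∧
    (∀ lam : J → ℝ, (∀ j, 0 ≤ lam j) → ∀ μ : List J → ℝ, G.IsStationaryState lam μ →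
      G.internalInflow μ = (1 - G.Pᵀ)⁻¹ *ᵥ (G.Pᵀ *ᵥ lam)) ∧
    ∃ ε : ℝ, 0 < ε ∧ ∀ lam : J → ℝ, (∀ j, 0 ≤ lam j ∧ lam j ≤ ε) →
      ∃! μ : List J → ℝ, G.IsStationaryState lam μ := by
  refine ⟨G.isUnit_one_sub_transpose, fun lam _ μ h => G.internalInflow_eq h, ?_⟩
  set S : ℝ := ∑ j, ∑ k, |(1 - G.Pᵀ)⁻¹ j k|
  have hS : 0 ≤ S := Finset.sum_nonneg fun j _ => Finset.sum_nonneg fun k _ => abs_nonneg _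
  -- The total inflow `∑ j, v j` is at most `S * ε`.
  refine ⟨G.γminus / (5 * (1 + S)), div_pos G.γminus_pos (by positivity), fun lam hlam => ?_⟩
  simp only [OpenNetwork.isStationaryState_iff_traffic]
  refine G.existsUnique_stationary
    (G.traffic_nonneg (fun j => (hlam j).1) (G.traffic_iff.2 rfl)) ?_
  set ε : ℝ := G.γminus / (5 * (1 + S))
  have hε : 0 < ε := div_pos G.γminus_pos (by positivity)
  have h1 : ∑ j, ((1 - G.Pᵀ)⁻¹ *ᵥ lam) j ≤ S * ε := by
    simp only [S, Finset.sum_mul]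
    refine Finset.sum_le_sum fun j _ => Finset.sum_le_sum fun k _ => ?_
    exact mul_le_mul (le_abs_self _) (hlam k).2 (hlam k).1 (abs_nonneg _)
  have h2 : ε * (5 * (1 + S)) = G.γminus := div_mul_cancel₀ _ (by positivity)
  linarith
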